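/- Let $M,K\in\mathbb R^{n\times n}$ be symmetric positive definite matrices (the mass and stiffness matrix) and $L=M^{-1}K$. Let $(x,y)_G=x^TGy$, with $G\in\mathbb R^{n\times n}$ symmetric positive definite, be an inner product on $\mathbb R^n$ with respect to which $L$ is self-adjoint, and let $\|x\|=(x,x)_G^{1/2}$. (The choice $G=M$ is always admissible; if $L$ is symmetric, so is $G=I$, for which $\|\cdot\|$ is the Euclidean norm.) Let $\Lambda=[\lambda_{\min}(L),\lambda_{\max}(L)]$ be the spectral interval of $L$ and let $b\in\mathbb R^n$. For $t\in[0,\infty)$ put $w(t)=(tI+L)^{-1}b$, and put $w(\infty)=b$. Let $t_0,\dots,t_k\in[0,\infty]$ be pairwise distinct, let $\mathcal V_{k+1}=\operatorname{span}\{w(t_0),\dots,w(t_k)\}$, and let $V$ be a matrix whose columns form a basis of $\mathcal V_{k+1}$ that is orthonormal with respect to $(\cdot,\cdot)_G$. Let $V^\star=V^TG$ be the adjoint of $V$ (so $V^\star=V^T$ if $G=I$), and let $$w_{k+1}(t)=V\,(tI+V^\star LV)^{-1}V^\star b$$ be the reduced basis approximation of $w(t)$. Then for every $t\ge 0$ and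 every interval $\Sigma=[\lambda_l,\lambda_u]\supseteq\Lambda$ with $\lambda_l>0$, $$\|w_{k+1}(t)-w(t)\|\le\frac{2C}{t+\lambda_l}\,\|\Theta\|_{L_\infty(\Sigma)}\,\|b\|\quad\text{with } C=1,\qquad \Theta(z)=\prod_{\substack{j=0\\ t_j\ne\infty}}^k\frac{z-t_j}{z+t_j},$$ where $\|\Theta\|_{L_\infty(\Sigma)}=\sup_{z\in\Sigma}|\Theta(z)|$. -/

import Mathlib

open scoped Matrix ENNReal

noncomputable section

namespace ReducedBasis

/-- The bilinear form `(x, y)_G = xᵀ G y` (an inner product on `ℝⁿ` if `G` is positive definite). -/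
def ip {n : ℕ} (G : Matrix (Fin n) (Fin n) ℝ) (x y : Fin n → ℝ) : ℝ :=
  x ⬝ᵥ (G *ᵥ y)

/-- The norm `‖x‖_G = (x, x)_G ^ (1/2)`. For `G = 1` this is the Euclidean norm. -/
def ipNorm {n : ℕ} (G : Matrix (Fin n) (Fin n) ℝ) (x : Fin n → ℝ) : ℝ :=
  Real.sqrt (ip G x x)

/-- `L` is self-adjoint with respect to the inner product `(·, ·)_G`. -/
def SelfAdjointWrt {n : ℕ} (G L : Matrix (Fin n) (Fin n) ℝ) : Prop :=
  ∀ x y : Fin n → ℝ, ip G (L *ᵥ x) y = ip G x (L *ᵥ y)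

/-- The discrete diffusion operator `L = M⁻¹ K` (`M` the mass matrix, `K` the stiffness matrix). -/
def diffusionMatrix {n : ℕ} (M K : Matrix (Fin n) (Fin n) ℝ) : Matrix (Fin n) (Fin n) ℝ :=
  M⁻¹ * K

/-- `L = M⁻¹ K` is always self-adjoint in the inner product given by the mass matrix `M`. -/
theorem selfAdjointWrt_mass {n : ℕ} {M K : Matrix (Fin n) (Fin n) ℝ}
    (hM : M.PosDef) (hK : K.PosDef) : SelfAdjointWrt M (diffusionMatrix M K) := by
  intro x y
  have hu : IsUnit M.det := (Matrix.isUnit_iff_isUnit_det M).1 hM.isUnit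
  have hMt : Mᵀ = M := by
    rw [← Matrix.conjTranspose_eq_transpose_of_trivial]
    exact hM.isHermitian.eq
  have hKt : Kᵀ = K := by
    rw [← Matrix.conjTranspose_eq_transpose_of_trivial]
    exact hK.isHermitian.eq
  have h1 : M * (M⁻¹ * K) = K := Matrix.mul_nonsing_inv_cancel_left M K hu
  have h2 : (M⁻¹ * K)ᵀ * M = K := by
    have := congrArg Matrix.transpose h1
    rwa [Matrix.transpose_mul, hMt, hKt] at this
  unfold ip diffusionMatrix
  rw [Matrix.mulVec_mulVec, h1, ← Matrix.vecMul_transpose, ← Matrix.dotProduct_mulVec,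
    Matrix.mulVec_mulVec, h2]

/-- The symmetric matrices are the ones that are self-adjoint in the Euclidean inner product. -/
theorem selfAdjointWrt_one {n : ℕ} {L : Matrix (Fin n) (Fin n) ℝ} (hL : L.IsSymm) :
    SelfAdjointWrt 1 L := by
  intro x y
  unfold ip
  rw [Matrix.one_mulVec, Matrix.one_mulVec, ← Matrix.vecMul_transpose, hL.eq,
    ← Matrix.dotProduct_mulVec]

/-- The spectral interval `Λ = [λ_min(L), λ_max(L)]`. -/
def spectralInterval {n : ℕ} (L : Matrix (Fin n) (Fin n) ℝ) : Set ℝ :=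
  Set.Icc (sInf (spectrum ℝ L)) (sSup (spectrum ℝ L))

/-- The solution `w(t) = (t I + L)⁻¹ b` of the parametric reaction-diffusion equation
for a finite parameter `t`. -/
def resolventSolution {n : ℕ} (L : Matrix (Fin n) (Fin n) ℝ) (b : Fin n → ℝ) (t : ℝ) :
    Fin n → ℝ :=
  (t • (1 : Matrix (Fin n) (Fin n) ℝ) + L)⁻¹ *ᵥ b

/-- `w(τ)` for an extended parameter `τ ∈ [0, ∞]`, with the convention `w(∞) = b`. -/
def snapshotSolution {n : ℕ} (L : Matrix (Fin n) (Fin n) ℝ) (b : Fin n → ℝ) (τ : ℝ≥0∞) :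
    Fin n → ℝ :=
  if τ = ∞ then b else resolventSolution L b τ.toReal

/-- The reduced space `span {w(t₀), …, w(t_k)}`. -/
def reducedSpace {n k : ℕ} (L : Matrix (Fin n) (Fin n) ℝ) (b : Fin n → ℝ)
    (τ : Fin (k + 1) → ℝ≥0∞) : Submodule ℝ (Fin n → ℝ) :=
  Submodule.span ℝ (Set.range fun j => snapshotSolution L b (τ j))

/-- The columns of `V` form a basis of the subspace `S` that is orthonormal for `(·, ·)_G`. -/
def IsOrthonormalBasisOf {n m : ℕ} (G : Matrix (Fin n) (Fin n) ℝ)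
    (V : Matrix (Fin n) (Fin m) ℝ) (S : Submodule ℝ (Fin n → ℝ)) : Prop :=
  Vᵀ * G * V = 1 ∧ Submodule.span ℝ (Set.range fun i => Vᵀ i) = S

/-- The reduced basis (Galerkin) approximation `V (t I + V⋆ L V)⁻¹ V⋆ b`, where `V⋆ = Vᵀ G` is the
adjoint of `V` with respect to `(·, ·)_G` (so `V⋆ = Vᵀ` in the Euclidean case `G = 1`). -/
def rbApprox {n m : ℕ} (G L : Matrix (Fin n) (Fin n) ℝ) (b : Fin n → ℝ)
    (V : Matrix (Fin n) (Fin m) ℝ) (t : ℝ) : Fin n → ℝ :=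
  V *ᵥ ((t • (1 : Matrix (Fin m) (Fin m) ℝ) + (Vᵀ * G) * L * V)⁻¹ *ᵥ ((Vᵀ * G) *ᵥ b))

open Classical in
/-- `Θ(z) = ∏_{t_j ≠ ∞} (z - t_j) / (z + t_j)`. -/
def Theta {k : ℕ} (τ : Fin (k + 1) → ℝ≥0∞) (z : ℝ) : ℝ :=
  ∏ j with τ j ≠ ∞, (z - (τ j).toReal) / (z + (τ j).toReal)

/-- The maximum norm of `f` on the set `S`. -/
def supNormOn (S : Set ℝ) (f : ℝ → ℝ) : ℝ :=
  sSup ((fun z => |f z|) '' S)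

end ReducedBasis

end

/-!
A Galerkin approximation on a space containing the snapshots `w(sⱼ)` reproduces them. Hence for
every choice of coefficients `aⱼ` both the exact solution `w(t)` and its reduced basis approximation
differ from `∑ aⱼ w(sⱼ)` by at most `sup |1 / (t + z) - ∑ aⱼ / (z + sⱼ)| ‖b‖`, the supremum being
over an interval that contains the spectrum of the operator and thus that of its compression. By
partial fractions the `aⱼ` can be chosen such that `1 / (t + z) - ∑ aⱼ / (z + sⱼ)` equals
`Θ(t) Θ(z) / (t + z)`, where `|Θ(t)| ≤ 1`. The factor `2` comes from the triangle inequality.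
-/

namespace ReducedBasis

section RationalApproximation

open Polynomial Lagrange Finset

theorem eval_div_eval_nodal_eq_sum {F ι : Type*} [Field F] [DecidableEq ι] {J : Finset ι}
    {v : ι → F} (hv : Set.InjOn v J) {p : F[X]} (hp : p.degree < #J) {x : F}
    (hx : ∀ j ∈ J, x ≠ v j) :
    p.eval x / (nodal J v).eval x =
      ∑ j ∈ J, nodalWeight J v j * p.eval (v j) / (x - v j) := by
  have hnodal : (nodal J v).eval x ≠ 0 := eval_nodal_not_at_node hx
  rw [div_eq_iff hnodal, mul_comm]
  nth_rewrite 1 [eq_interpolate hv hp]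
  rw [eval_interpolate_not_at_node _ hx]
  congr 1
  exact sum_congr rfl fun j _ => by ring

variable {ι : Type*} [Fintype ι] {s : ι → ℝ} {t : ℝ}

/-- The rational function `Θ(z) = ∏ (z - sⱼ) / (z + sⱼ)`, with zeros `sⱼ` and poles `-sⱼ`. In
contrast to `Theta`, all parameters `sⱼ` are finite. -/
noncomputable def blaschkeProduct (s : ι → ℝ) (z : ℝ) : ℝ :=
  ∏ j, (z - s j) / (z + s j)

theorem abs_blaschkeProduct_le_one (hs : 0 ≤ s) {z : ℝ} (hz : 0 ≤ z) :
    |blaschkeProduct s z| ≤ 1 := by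
  rw [blaschkeProduct, abs_prod]
  refine prod_le_one (fun _ _ => abs_nonneg _) fun j _ => ?_
  have hsj : 0 ≤ s j := hs j
  rw [abs_div, abs_of_nonneg (add_nonneg hz hsj)]
  exact div_le_one_of_le₀ (abs_le.2 ⟨by linarith, by linarith⟩) (add_nonneg hz hsj)

theorem supNormOn_nonneg (S : Set ℝ) (f : ℝ → ℝ) : 0 ≤ supNormOn S f :=
  Real.sSup_nonneg (Set.forall_mem_image.2 fun _ _ => abs_nonneg _)

theorem abs_blaschkeProduct_le_supNormOn (hs : 0 ≤ s) {S : Set ℝ} (hS : S ⊆ Set.Ici 0) {z : ℝ}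
    (hz : z ∈ S) : |blaschkeProduct s z| ≤ supNormOn S (blaschkeProduct s) :=
  le_csSup ⟨1, Set.forall_mem_image.2 fun _ hy => abs_blaschkeProduct_le_one hs (hS hy)⟩
    ⟨z, hz, rfl⟩

theorem eval_nodal_neg_eq_blaschkeProduct_mul (hs : 0 ≤ s) (ht : 0 ≤ t) :
    (nodal univ (-s)).eval (-t) = blaschkeProduct s t * (nodal univ s).eval (-t) := by
  rw [eval_nodal, eval_nodal, blaschkeProduct, ← prod_mul_distrib]
  refine prod_congr rfl fun j _ => ?_
  have hsj : 0 ≤ s j := hs j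
  rw [Pi.neg_apply, sub_neg_eq_add]
  -- If `t + sⱼ = 0` then `t = sⱼ = 0`, and both sides vanish although the quotient is junk.
  rcases (add_nonneg ht hsj).eq_or_lt' with h | h
  · rw [h, div_zero, zero_mul]
    linarith
  · field_simp
    ring

theorem exists_X_add_C_mul_eq_nodal_sub_nodal (hs : 0 ≤ s) (ht : 0 ≤ t) :
    ∃ p : ℝ[X], p.degree < #(univ : Finset ι) ∧
      (X + C t) * p = nodal univ (-s) - C (blaschkeProduct s t) * nodal univ s := by
  obtain ⟨p, hp⟩ : X - C (-t) ∣ nodal univ (-s) - C (blaschkeProduct s t) * nodal univ s := by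
    rw [dvd_iff_isRoot, IsRoot, eval_sub, eval_C_mul,
      eval_nodal_neg_eq_blaschkeProduct_mul hs ht, sub_self]
  rw [C_neg, sub_neg_eq_add] at hp
  refine ⟨p, ?_, hp.symm⟩
  rcases eq_or_ne p 0 with rfl | hp0
  · simp
  have hdeg : ((X + C t) * p).natDegree ≤ #(univ : Finset ι) := by
    rw [← hp]
    refine (natDegree_sub_le _ _).trans (max_le natDegree_nodal.le ?_)
    exact (natDegree_C_mul_le _ _).trans natDegree_nodal.le
  rw [natDegree_mul (X_add_C_ne_zero t) hp0, natDegree_X_add_C, add_comm] at hdeg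
  rw [degree_eq_natDegree hp0]
  exact_mod_cast hdeg

theorem exists_one_div_add_sub_sum_eq (hs : 0 ≤ s) (hinj : Function.Injective s) (ht : 0 ≤ t) :
    ∃ a : ι → ℝ, ∀ z, 0 < z →
      1 / (t + z) - ∑ j, a j / (z + s j) =
        blaschkeProduct s t * blaschkeProduct s z / (t + z) := by
  classical
  obtain ⟨p, hdeg, hp⟩ := exists_X_add_C_mul_eq_nodal_sub_nodal hs ht
  refine ⟨fun j => nodalWeight univ (-s) j * p.eval ((-s) j), fun z hz => ?_⟩
  have hne : ∀ j ∈ univ, z ≠ (-s) j := fun j _ =>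
    ((neg_nonpos.2 (hs j)).trans_lt hz).ne'
  have hQ : (nodal univ (-s)).eval z ≠ 0 := eval_nodal_not_at_node hne
  have hfrac : ∑ j, nodalWeight univ (-s) j * p.eval ((-s) j) / (z + s j) =
      p.eval z / (nodal univ (-s)).eval z := by
    rw [eval_div_eval_nodal_eq_sum (v := -s) (neg_injective.comp hinj).injOn hdeg hne]
    simp only [Pi.neg_apply, sub_neg_eq_add]
  have hΘ : blaschkeProduct s z = (nodal univ s).eval z / (nodal univ (-s)).eval z := by
    simp only [blaschkeProduct, eval_nodal, prod_div_distrib, Pi.neg_apply, sub_neg_eq_add]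
  have hpz := congrArg (eval z) hp
  simp only [eval_mul, eval_add, eval_X, eval_C, eval_sub] at hpz
  have htz : t + z ≠ 0 := by positivity
  rw [hfrac, hΘ]
  field_simp
  linear_combination -hpz

theorem exists_abs_one_div_add_sub_sum_le (hs : 0 ≤ s) (hinj : Function.Injective s)
    (ht : 0 ≤ t) {l : ℝ} (hl : 0 < l) (u : ℝ) :
    ∃ a : ι → ℝ, ∀ z ∈ Set.Icc l u,
      |1 / (t + z) - ∑ j, a j / (z + s j)| ≤
        supNormOn (Set.Icc l u) (blaschkeProduct s) / (t + l) := by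
  obtain ⟨a, ha⟩ := exists_one_div_add_sub_sum_eq hs hinj ht
  refine ⟨a, fun z hz => ?_⟩
  have hz0 : 0 < z := hl.trans_le hz.1
  rw [ha z hz0, abs_div, abs_mul, abs_of_pos (by positivity : 0 < t + z)]
  refine div_le_div₀ (supNormOn_nonneg _ _) ?_ (by positivity) (by linarith [hz.1])
  calc |blaschkeProduct s t| * |blaschkeProduct s z|
      ≤ |blaschkeProduct s z| :=
        mul_le_of_le_one_left (abs_nonneg _) (abs_blaschkeProduct_le_one hs ht)
    _ ≤ supNormOn (Set.Icc l u) (blaschkeProduct s) :=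
        abs_blaschkeProduct_le_supNormOn hs (fun _ hy => hl.le.trans hy.1) hz

end RationalApproximation

section InnerProductSpace

open scoped InnerProductSpace
open Module.End

theorem norm_le_mul_norm_of_norm_inner_le {ι 𝕜 E : Type*} [RCLike 𝕜] [NormedAddCommGroup E]
    [InnerProductSpace 𝕜 E] [Fintype ι] (e : OrthonormalBasis ι 𝕜 E) {B : ℝ} (hB : 0 ≤ B)
    {x y : E} (h : ∀ i, ‖⟪e i, x⟫_𝕜‖ ≤ B * ‖⟪e i, y⟫_𝕜‖) : ‖x‖ ≤ B * ‖y‖ := by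
  refine le_of_sq_le_sq ?_ (by positivity)
  rw [mul_pow, ← e.sum_sq_norm_inner_right x, ← e.sum_sq_norm_inner_right y, Finset.mul_sum]
  refine Finset.sum_le_sum fun i _ => ?_
  rw [← mul_pow]
  gcongr
  exact h i

variable {E : Type*} [NormedAddCommGroup E] [InnerProductSpace ℝ E] {T : E →ₗ[ℝ] E} {l u : ℝ}

/-- The quadratic form of `T` is enclosed by `l` and `u`. For symmetric `T` in finite dimensions
this is an enclosure of the spectrum, in a form that visibly passes to compressions of `T`. -/
def FormBounds (T : E →ₗ[ℝ] E) (l u : ℝ) : Prop :=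
  ∀ x, ⟪x, T x⟫_ℝ ∈ Set.Icc (l * ‖x‖ ^ 2) (u * ‖x‖ ^ 2)

theorem FormBounds.mem_Icc_of_hasEigenvalue (hT : FormBounds T l u) {μ : ℝ}
    (hμ : HasEigenvalue T μ) : μ ∈ Set.Icc l u := by
  obtain ⟨v, hv⟩ := hμ.exists_hasEigenvector
  have hpos : 0 < ‖v‖ ^ 2 := by have := norm_pos_iff.2 hv.2; positivity
  have h := hT v
  rw [hv.apply_eq_smul, real_inner_smul_right, real_inner_self_eq_norm_sq] at h
  exact ⟨le_of_mul_le_mul_right h.1 hpos, le_of_mul_le_mul_right h.2 hpos⟩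

theorem formBounds_of_hasEigenvalue_mem_Icc [FiniteDimensional ℝ E] (hT : T.IsSymmetric)
    (h : ∀ μ, HasEigenvalue T μ → μ ∈ Set.Icc l u) : FormBounds T l u := by
  intro x
  set e := hT.eigenvectorBasis rfl
  have hμ : ∀ i, hT.eigenvalues rfl i ∈ Set.Icc l u := fun i =>
    h _ (hT.hasEigenvalue_eigenvalues rfl i)
  have hform : ⟪x, T x⟫_ℝ = ∑ i, hT.eigenvalues rfl i * ‖⟪e i, x⟫_ℝ‖ ^ 2 := by
    rw [← e.sum_inner_mul_inner]
    refine Finset.sum_congr rfl fun i _ => ?_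
    rw [← hT, hT.apply_eigenvectorBasis, RCLike.ofReal_real_eq_id, id, real_inner_smul_left,
      real_inner_comm, Real.norm_eq_abs, sq_abs]
    ring
  rw [hform, ← e.sum_sq_norm_inner_right x, Finset.mul_sum, Finset.mul_sum]
  exact ⟨Finset.sum_le_sum fun i _ => by gcongr; exact (hμ i).1,
    Finset.sum_le_sum fun i _ => by gcongr; exact (hμ i).2⟩

variable {ι : Type*} [Fintype ι] {s a : ι → ℝ} {b x : E} {t B : ℝ}

theorem norm_sub_sum_smul_le [FiniteDimensional ℝ E] (hT : T.IsSymmetric)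
    (hTlu : FormBounds T l u) (hl : 0 < l) (ht : 0 ≤ t) (hs : 0 ≤ s) (hB₀ : 0 ≤ B)
    (hB : ∀ z ∈ Set.Icc l u, |1 / (t + z) - ∑ j, a j / (z + s j)| ≤ B)
    (hx : t • x + T x = b) {y : ι → E} (hy : ∀ j, s j • y j + T (y j) = b) :
    ‖x - ∑ j, a j • y j‖ ≤ B * ‖b‖ := by
  set e := hT.eigenvectorBasis rfl
  set μ := hT.eigenvalues rfl
  have hμ : ∀ i, μ i ∈ Set.Icc l u := fun i =>
    hTlu.mem_Icc_of_hasEigenvalue (hT.hasEigenvalue_eigenvalues rfl i)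
  have hcoord : ∀ i {r : ℝ} {w : E}, 0 ≤ r → r • w + T w = b →
      ⟪e i, w⟫_ℝ = ⟪e i, b⟫_ℝ / (μ i + r) := by
    intro i r w hr hw
    have hpos : 0 < μ i + r := by linarith [(hμ i).1]
    rw [eq_div_iff hpos.ne', ← hw, inner_add_right, ← hT, hT.apply_eigenvectorBasis,
      real_inner_smul_left, real_inner_smul_right]
    simp only [RCLike.ofReal_real_eq_id, id]
    ring
  refine norm_le_mul_norm_of_norm_inner_le e hB₀ fun i => ?_
  have herr : ⟪e i, x - ∑ j, a j • y j⟫_ℝ =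
      (1 / (t + μ i) - ∑ j, a j / (μ i + s j)) * ⟪e i, b⟫_ℝ := by
    rw [inner_sub_right, inner_sum, hcoord i ht hx, sub_mul, Finset.sum_mul, add_comm t,
      one_div_mul_eq_div]
    congr 1
    refine Finset.sum_congr rfl fun j _ => ?_
    rw [real_inner_smul_right, hcoord i (hs j) (hy j)]
    ring
  rw [herr, norm_mul]
  gcongr
  exact hB _ (hμ i)

variable {U : Submodule ℝ E}

/-- The compression `P_U T|_U` of an operator to a subspace, the coordinate-free form of the reduced
matrix `V⋆ L V`. -/
noncomputable def compression (T : E →ₗ[ℝ] E) (U : Submodule ℝ E) [U.HasOrthogonalProjection] :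
    U →ₗ[ℝ] U :=
  U.orthogonalProjectionOnto.toLinearMap ∘ₗ T ∘ₗ U.subtype

theorem inner_compression_right [U.HasOrthogonalProjection] (x y : U) :
    ⟪x, compression T U y⟫_ℝ = ⟪(x : E), T y⟫_ℝ :=
  U.inner_orthogonalProjectionOnto_eq_of_mem_left x (T y)

theorem isSymmetric_compression [U.HasOrthogonalProjection] (hT : T.IsSymmetric) :
    (compression T U).IsSymmetric := by
  intro x y
  rw [real_inner_comm, inner_compression_right, inner_compression_right, ← hT, real_inner_comm]

theorem FormBounds.compression [U.HasOrthogonalProjection] (hT : FormBounds T l u) :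
    FormBounds (compression T U) l u := by
  intro x
  rw [inner_compression_right]
  exact hT x

/-- `x` solves `(t + T) x = b` in the Galerkin sense: it lies in `U`, and its residual is orthogonal
to `U`. -/
structure IsGalerkinSolution (T : E →ₗ[ℝ] E) (b : E) (t : ℝ) (U : Submodule ℝ E) (x : E) :
    Prop where
  mem : x ∈ U
  inner_eq : ∀ v ∈ U, ⟪v, t • x + T x⟫_ℝ = ⟪v, b⟫_ℝ

theorem isGalerkinSolution_of_mem (hx : t • x + T x = b) (hxU : x ∈ U) :
    IsGalerkinSolution T b t U x :=
  ⟨hxU, fun _ _ => by rw [hx]⟩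

theorem IsGalerkinSolution.smul_add_compression_eq [U.HasOrthogonalProjection]
    (hx : IsGalerkinSolution T b t U x) :
    t • (⟨x, hx.mem⟩ : U) + compression T U ⟨x, hx.mem⟩ = U.orthogonalProjectionOnto b := by
  refine ext_inner_left ℝ fun v => ?_
  rw [inner_add_right, inner_compression_right, U.inner_orthogonalProjectionOnto_eq_of_mem_left,
    ← hx.inner_eq v v.2, inner_add_right]
  rfl

theorem IsGalerkinSolution.norm_sub_sum_smul_le [FiniteDimensional ℝ U] (hT : T.IsSymmetric)
    (hTlu : FormBounds T l u) (hl : 0 < l) (ht : 0 ≤ t) (hs : 0 ≤ s) (hB₀ : 0 ≤ B)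
    (hB : ∀ z ∈ Set.Icc l u, |1 / (t + z) - ∑ j, a j / (z + s j)| ≤ B)
    (hx : IsGalerkinSolution T b t U x) {y : ι → E}
    (hy : ∀ j, IsGalerkinSolution T b (s j) U (y j)) :
    ‖x - ∑ j, a j • y j‖ ≤ B * ‖b‖ := by
  have hU := ReducedBasis.norm_sub_sum_smul_le (isSymmetric_compression (U := U) hT)
    hTlu.compression hl ht hs hB₀ hB hx.smul_add_compression_eq
    fun j => (hy j).smul_add_compression_eq
  calc ‖x - ∑ j, a j • y j‖
      = ‖(⟨x, hx.mem⟩ : U) - ∑ j, a j • (⟨y j, (hy j).mem⟩ : U)‖ := by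
        simp only [Submodule.coe_norm, AddSubgroupClass.coe_sub, Submodule.coe_sum,
          Submodule.coe_smul]
    _ ≤ B * ‖U.orthogonalProjectionOnto b‖ := hU
    _ ≤ B * ‖b‖ := by
        gcongr
        exact U.norm_orthogonalProjectionOnto_apply_le b

theorem IsGalerkinSolution.norm_sub_le [FiniteDimensional ℝ U] (hT : T.IsSymmetric)
    (hTlu : FormBounds T l u) (hl : 0 < l) (ht : 0 ≤ t) (hs : 0 ≤ s)
    (hinj : Function.Injective s) (hU : ∀ j, ∃ y ∈ U, s j • y + T y = b)
    (hx : IsGalerkinSolution T b t U x) {w : E} (hw : t • w + T w = b) :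
    ‖x - w‖ ≤ 2 / (t + l) * supNormOn (Set.Icc l u) (blaschkeProduct s) * ‖b‖ := by
  choose y hyU hy using hU
  obtain ⟨a, ha⟩ := exists_abs_one_div_add_sub_sum_le hs hinj ht hl u
  set B := supNormOn (Set.Icc l u) (blaschkeProduct s) / (t + l) with hB
  have hB₀ : 0 ≤ B := div_nonneg (supNormOn_nonneg _ _) (by positivity)
  have hxB : ‖x - ∑ j, a j • y j‖ ≤ B * ‖b‖ :=
    hx.norm_sub_sum_smul_le hT hTlu hl ht hs hB₀ ha
      fun j => isGalerkinSolution_of_mem (hy j) (hyU j)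
  -- The exact solution is its own Galerkin approximation on the larger space `U ⊔ ℝ ∙ w`.
  have hwW : w ∈ U ⊔ ℝ ∙ w := Submodule.mem_sup_right (Submodule.mem_span_singleton_self w)
  have hwB : ‖w - ∑ j, a j • y j‖ ≤ B * ‖b‖ :=
    (isGalerkinSolution_of_mem hw hwW).norm_sub_sum_smul_le hT hTlu hl ht hs hB₀ ha
      fun j => isGalerkinSolution_of_mem (hy j) (Submodule.mem_sup_left (hyU j))
  calc ‖x - w‖ ≤ ‖x - ∑ j, a j • y j‖ + ‖w - ∑ j, a j • y j‖ := by
        simpa only [dist_eq_norm] using dist_triangle_right x w (∑ j, a j • y j)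
    _ ≤ B * ‖b‖ + B * ‖b‖ := add_le_add hxB hwB
    _ = 2 / (t + l) * supNormOn (Set.Icc l u) (blaschkeProduct s) * ‖b‖ := by rw [hB]; ring

end InnerProductSpace

section Matrix

open scoped InnerProductSpace

variable {n m : ℕ} {G L A : Matrix (Fin n) (Fin n) ℝ} {V : Matrix (Fin n) (Fin m) ℝ}
  {b : Fin n → ℝ} {l u t : ℝ}

theorem ip_self_pos (hG : G.PosDef) {x : Fin n → ℝ} (hx : x ≠ 0) : 0 < ip G x x := by
  simpa only [ip, star_trivial] using hG.dotProduct_mulVec_pos hx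

theorem isUnit_of_forall_ip_mulVec_pos (hA : ∀ x, x ≠ 0 → 0 < ip G x (A *ᵥ x)) : IsUnit A := by
  rw [← Matrix.mulVec_injective_iff_isUnit, ← Matrix.coe_mulVecLin, ← LinearMap.ker_eq_bot,
    LinearMap.ker_eq_bot']
  intro x hx
  by_contra hx₀
  have hpos := hA x hx₀
  rw [← Matrix.mulVecLin_apply, hx, ip, Matrix.mulVec_zero, dotProduct_zero] at hpos
  exact hpos.false

theorem smul_resolventSolution_add_mulVec
    (hA : IsUnit (t • (1 : Matrix (Fin n) (Fin n) ℝ) + L)) :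
    t • resolventSolution L b t + L *ᵥ resolventSolution L b t = b := by
  have h : (t • (1 : Matrix (Fin n) (Fin n) ℝ) + L) *ᵥ resolventSolution L b t = b := by
    rw [resolventSolution, Matrix.mulVec_mulVec,
      Matrix.mul_nonsing_inv _ ((Matrix.isUnit_iff_isUnit_det _).1 hA), Matrix.one_mulVec]
  rwa [Matrix.add_mulVec, Matrix.smul_mulVec, Matrix.one_mulVec] at h

theorem ip_one_adjoint_mulVec (x : Fin m → ℝ) (y : Fin n → ℝ) :
    ip 1 x ((Vᵀ * G) *ᵥ y) = ip G (V *ᵥ x) y := by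
  rw [ip, ip, Matrix.one_mulVec, ← Matrix.mulVec_mulVec, Matrix.dotProduct_mulVec,
    Matrix.vecMul_transpose]

theorem isUnit_adjoint_mul_mul (hV : Vᵀ * G * V = 1) (hA : ∀ x, x ≠ 0 → 0 < ip G x (A *ᵥ x)) :
    IsUnit (Vᵀ * G * A * V) := by
  refine isUnit_of_forall_ip_mulVec_pos (G := 1) fun y hy => ?_
  have hVy : V *ᵥ y ≠ 0 := fun h => hy <| by
    rw [← Matrix.one_mulVec y, ← hV, ← Matrix.mulVec_mulVec, h, Matrix.mulVec_zero]
  rw [Matrix.mul_assoc, ← Matrix.mulVec_mulVec, ip_one_adjoint_mulVec, ← Matrix.mulVec_mulVec]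
  exact hA _ hVy

theorem ip_mulVec_mulVec_rbApprox (hV : Vᵀ * G * V = 1)
    (hA : ∀ x, x ≠ 0 → 0 < ip G x ((t • (1 : Matrix (Fin n) (Fin n) ℝ) + L) *ᵥ x))
    (v : Fin m → ℝ) :
    ip G (V *ᵥ v) ((t • (1 : Matrix (Fin n) (Fin n) ℝ) + L) *ᵥ rbApprox G L b V t) =
      ip G (V *ᵥ v) b := by
  have hcompr : Vᵀ * G * (t • 1 + L) * V = t • 1 + Vᵀ * G * L * V := by
    rw [Matrix.mul_add, Matrix.add_mul, Matrix.mul_smul, Matrix.mul_one, Matrix.smul_mul, hV]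
  have hdet := (Matrix.isUnit_iff_isUnit_det _).1 (isUnit_adjoint_mul_mul hV hA)
  rw [rbApprox, ← hcompr, ← ip_one_adjoint_mulVec, ← ip_one_adjoint_mulVec]
  simp only [Matrix.mulVec_mulVec]
  rw [← Matrix.mul_assoc, ← Matrix.mul_assoc, ← Matrix.mul_assoc, Matrix.mul_nonsing_inv _ hdet,
    Matrix.one_mul]

open scoped MatrixOrder in
theorem exists_linearEquiv_inner_eq_ip (hG : G.PosDef) :
    ∃ φ : (Fin n → ℝ) ≃ₗ[ℝ] EuclideanSpace ℝ (Fin n), ∀ x y, ⟪φ x, φ y⟫_ℝ = ip G x y := by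
  obtain ⟨B, hB⟩ := CStarAlgebra.nonneg_iff_eq_star_mul_self.1 hG.posSemidef.nonneg
  rw [Matrix.star_eq_conjTranspose, Matrix.conjTranspose_eq_transpose_of_trivial] at hB
  let f : (Fin n → ℝ) →ₗ[ℝ] EuclideanSpace ℝ (Fin n) :=
    (WithLp.linearEquiv 2 ℝ (Fin n → ℝ)).symm.toLinearMap ∘ₗ B.toLin'
  have hf : ∀ x y, ⟪f x, f y⟫_ℝ = ip G x y := fun x y => by
    have hinner : ⟪f x, f y⟫_ℝ = (B *ᵥ y) ⬝ᵥ (B *ᵥ x) := rfl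
    rw [hinner, ip, hB, ← Matrix.mulVec_mulVec, Matrix.dotProduct_mulVec x,
      Matrix.vecMul_transpose, dotProduct_comm]
  have hinj : Function.Injective f := by
    rw [← LinearMap.ker_eq_bot, LinearMap.ker_eq_bot']
    intro x hx
    by_contra hx₀
    have hpos := ip_self_pos hG hx₀
    rw [← hf, hx, inner_zero_left] at hpos
    exact hpos.false
  exact ⟨f.linearEquivOfInjective hinj (by simp), hf⟩

theorem mem_spectralInterval_of_mem_spectrum {μ : ℝ} (hμ : μ ∈ spectrum ℝ L) :
    μ ∈ spectralInterval L :=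
  ⟨csInf_le L.finite_spectrum.bddBelow hμ, le_csSup L.finite_spectrum.bddAbove hμ⟩

variable {E : Type*} [NormedAddCommGroup E] [InnerProductSpace ℝ E] {φ : (Fin n → ℝ) ≃ₗ[ℝ] E}

theorem norm_eq_ipNorm (hφ : ∀ x y, ⟪φ x, φ y⟫_ℝ = ip G x y) (x : Fin n → ℝ) :
    ‖φ x‖ = ipNorm G x := by
  rw [norm_eq_sqrt_real_inner, hφ, ipNorm]

theorem conj_toLin'_apply (x : Fin n → ℝ) : φ.conj L.toLin' (φ x) = φ (L *ᵥ x) := by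
  rw [LinearEquiv.conj_apply_apply, φ.symm_apply_apply, Matrix.toLin'_apply]

theorem smul_add_conj_toLin'_apply (x : Fin n → ℝ) :
    t • φ x + φ.conj L.toLin' (φ x) = φ ((t • (1 : Matrix (Fin n) (Fin n) ℝ) + L) *ᵥ x) := by
  rw [conj_toLin'_apply, Matrix.add_mulVec, Matrix.smul_mulVec, Matrix.one_mulVec, map_add,
    map_smul]

theorem isSymmetric_conj_toLin' (hφ : ∀ x y, ⟪φ x, φ y⟫_ℝ = ip G x y)
    (hL : SelfAdjointWrt G L) : (φ.conj L.toLin').IsSymmetric := by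
  intro x y
  obtain ⟨x, rfl⟩ := φ.surjective x
  obtain ⟨y, rfl⟩ := φ.surjective y
  rw [conj_toLin'_apply, conj_toLin'_apply, hφ, hφ, hL]

theorem formBounds_conj_toLin' (hφ : ∀ x y, ⟪φ x, φ y⟫_ℝ = ip G x y)
    (hL : SelfAdjointWrt G L) (hlu : spectralInterval L ⊆ Set.Icc l u) :
    FormBounds (φ.conj L.toLin') l u := by
  have := φ.finiteDimensional
  refine formBounds_of_hasEigenvalue_mem_Icc (isSymmetric_conj_toLin' hφ hL) fun μ hμ => hlu ?_
  have hspec : spectrum ℝ (φ.conj L.toLin') = spectrum ℝ L := by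
    rw [← Matrix.spectrum_toLin', ← AlgEquiv.spectrum_eq (φ.conjAlgEquiv ℝ) L.toLin']
    rfl
  exact mem_spectralInterval_of_mem_spectrum (hspec ▸ hμ.mem_spectrum)

theorem ip_mulVec_pos (hφ : ∀ x y, ⟪φ x, φ y⟫_ℝ = ip G x y)
    (hlu : FormBounds (φ.conj L.toLin') l u) (hl : 0 < l) (ht : 0 ≤ t) {x : Fin n → ℝ}
    (hx : x ≠ 0) : 0 < ip G x ((t • (1 : Matrix (Fin n) (Fin n) ℝ) + L) *ᵥ x) := by
  have hnorm : 0 < ‖φ x‖ := norm_pos_iff.2 (φ.map_ne_zero_iff.2 hx)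
  rw [← hφ, ← smul_add_conj_toLin'_apply, inner_add_right, real_inner_smul_right,
    real_inner_self_eq_norm_sq]
  have hform : 0 < ⟪φ x, φ.conj L.toLin' (φ x)⟫_ℝ :=
    (by positivity : 0 < l * ‖φ x‖ ^ 2).trans_le (hlu (φ x)).1
  positivity

theorem isGalerkinSolution_rbApprox {S : Submodule ℝ (Fin n → ℝ)}
    (hφ : ∀ x y, ⟪φ x, φ y⟫_ℝ = ip G x y) (hV : IsOrthonormalBasisOf G V S)
    (hA : ∀ x, x ≠ 0 → 0 < ip G x ((t • (1 : Matrix (Fin n) (Fin n) ℝ) + L) *ᵥ x)) :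
    IsGalerkinSolution (φ.conj L.toLin') (φ b) t (S.map φ.toLinearMap)
      (φ (rbApprox G L b V t)) := by
  have hS : S = V.mulVecLin.range := hV.2.symm.trans V.range_mulVecLin.symm
  refine ⟨Submodule.mem_map_of_mem (hS ▸ ⟨_, rfl⟩), ?_⟩
  rintro _ ⟨x, hx, rfl⟩
  obtain ⟨v, rfl⟩ : x ∈ V.mulVecLin.range := hS ▸ hx
  rw [smul_add_conj_toLin'_apply]
  exact (hφ _ _).trans ((ip_mulVec_mulVec_rbApprox hV.1 hA v).trans (hφ _ _).symm)

theorem theta_eq_blaschkeProduct {k : ℕ} (τ : Fin (k + 1) → ℝ≥0∞) :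
    Theta τ = blaschkeProduct fun j : {j // τ j ≠ ∞} => (τ j).toReal := by
  funext z
  rw [Theta, blaschkeProduct,
    Finset.prod_subtype (p := fun j => τ j ≠ ∞) _ fun j => Finset.mem_filter_univ j]

end Matrix

end ReducedBasis

open ReducedBasis in
theorem mainTheorem4_general {n k m : ℕ} {G L : Matrix (Fin n) (Fin n) ℝ} (hG : G.PosDef)
    (hL : SelfAdjointWrt G L) (b : Fin n → ℝ) {τ : Fin (k + 1) → ℝ≥0∞}
    (hτ : Set.InjOn τ {j | τ j ≠ ∞}) {V : Matrix (Fin n) (Fin m) ℝ}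
    {S : Submodule ℝ (Fin n → ℝ)} (hV : IsOrthonormalBasisOf G V S)
    (hS : ∀ j, τ j ≠ ∞ → snapshotSolution L b (τ j) ∈ S) {t : ℝ} (ht : 0 ≤ t) {l u : ℝ}
    (hl : 0 < l) (hlu : spectralInterval L ⊆ Set.Icc l u) :
    ipNorm G (rbApprox G L b V t - resolventSolution L b t) ≤
      2 / (t + l) * supNormOn (Set.Icc l u) (Theta τ) * ipNorm G b := by
  obtain ⟨φ, hφ⟩ := exists_linearEquiv_inner_eq_ip hG
  have hbounds := formBounds_conj_toLin' hφ hL hlu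
  have hpos {r : ℝ} (hr : 0 ≤ r) := fun x => ip_mulVec_pos (x := x) hφ hbounds hl hr
  have hsol {r : ℝ} (hr : 0 ≤ r) : r • φ (resolventSolution L b r) +
      φ.conj L.toLin' (φ (resolventSolution L b r)) = φ b := by
    rw [conj_toLin'_apply, ← map_smul, ← map_add,
      smul_resolventSolution_add_mulVec (isUnit_of_forall_ip_mulVec_pos (hpos hr))]
  have hinj : Function.Injective fun j : {j // τ j ≠ ∞} => (τ j).toReal := fun i j hij =>
    Subtype.ext (hτ i.2 j.2 ((ENNReal.toReal_eq_toReal_iff' i.2 j.2).1 hij))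
  have hsnap (j : {j // τ j ≠ ∞}) : resolventSolution L b (τ j).toReal ∈ S :=
    (if_neg j.2 : snapshotSolution L b (τ j) = _) ▸ hS j j.2
  have hgal := isGalerkinSolution_rbApprox (b := b) hφ hV (hpos ht)
  rw [← norm_eq_ipNorm hφ, ← norm_eq_ipNorm hφ, map_sub, theta_eq_blaschkeProduct]
  exact hgal.norm_sub_le (isSymmetric_conj_toLin' hφ hL) hbounds hl ht
    (fun _ => ENNReal.toReal_nonneg) hinj
    (fun j => ⟨_, Submodule.mem_map_of_mem (hsnap j), hsol ENNReal.toReal_nonneg⟩) (hsol ht)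

theorem mainTheorem4 {n k m : ℕ}
    (M K : Matrix (Fin n) (Fin n) ℝ) (hM : M.PosDef) (hK : K.PosDef)
    (G : Matrix (Fin n) (Fin n) ℝ) (hG : G.PosDef)
    (hL : ReducedBasis.SelfAdjointWrt G (ReducedBasis.diffusionMatrix M K))
    (b : Fin n → ℝ)
    (τ : Fin (k + 1) → ENNReal) (hτ : Function.Injective τ)
    (V : Matrix (Fin n) (Fin m) ℝ)
    (hV : ReducedBasis.IsOrthonormalBasisOf G V
      (ReducedBasis.reducedSpace (ReducedBasis.diffusionMatrix M K) b τ))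
    (t : ℝ) (ht : 0 ≤ t)
    (lamL lamU : ℝ) (hlam : 0 < lamL)
    (hSigma : ReducedBasis.spectralInterval (ReducedBasis.diffusionMatrix M K) ⊆
      Set.Icc lamL lamU) :
    ReducedBasis.ipNorm G
        (ReducedBasis.rbApprox G (ReducedBasis.diffusionMatrix M K) b V t -
          ReducedBasis.resolventSolution (ReducedBasis.diffusionMatrix M K) b t) ≤
      2 / (t + lamL) *
        ReducedBasis.supNormOn (Set.Icc lamL lamU) (ReducedBasis.Theta τ) *
        ReducedBasis.ipNorm G b :=
  mainTheorem4_general hG hL b hτ.injOn hV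
    (fun j _ => Submodule.subset_span ⟨j, rfl⟩) ht hlam hSigma
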